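/- Let $d\ge 2$ and let $E_d$ be the set of non-oriented nearest-neighbour edges of $\mathbb Z^d$. Let $Q$ be a probability measure on the space of environments $\Omega=[0,1]^{E_d}$ under which the conductances $(\omega(e))_{e\in E_d}$ are independent and identically distributed, and suppose that $Q(\omega(e)>0)=1$ for every $e\in E_d$. For an environment $\omega$ and a finite set $A\subset\mathbb Z^d$ put $$m^\omega(A)=\sum_{x\in A}\ \sum_{z\sim x}\omega(x,z),\qquad \partial A=\{(x,y):\ x\sim y,\ \omega(x,y)>0,\ x\in A,\ y\notin A\},\qquad \mu^\omega(\partial A)=\sum_{(x,y)\in\partial A}\omega(x,y),$$ where $x\sim y$ means that $x$ and $y$ are nearest neighbours and $\omega(x,y)=\omega(y,x)$ is the conductance of the edge between them. Then there is a constant $\beta_0=\beta_0(Q,d)>0$ such that for $Q$-almost every $\omega$ there exists $N_0(\omega)\in\mathbb N$ with the following property: every finite set $A\subset\mathbb Z^d$ which contains $0$, is connected in the nearest-neighbour graph of $\mathbb Z^d$ and satisfies $m^\omega(A)\ge N_0(\omega)$ also satisfies $$\mu^\omega(\partial A)\ \ge\ \beta_0\, m^\omega(A)^{1-1/d}.$$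 -/

import Mathlib

noncomputable section

namespace RandomConductance

/-- The nearest-neighbour lattice graph on `ℤ^d`: `x ∼ y` iff their `ℓ¹`-distance is `1`. -/
def lattice (d : ℕ) : SimpleGraph (Fin d → ℤ) where
  Adj x y := ∑ i, |x i - y i| = 1
  symm := ⟨fun x y h => by simpa only [abs_sub_comm] using h⟩
  loopless := ⟨fun x h => by simp at h⟩

theorem lattice_neighborSet_finite (d : ℕ) (x : Fin d → ℤ) :
    ((lattice d).neighborSet x).Finite := by
  refine (Set.finite_Icc (x - 1) (x + 1)).subset fun y hy => ?_
  have hy' : ∑ i, |x i - y i| = 1 := hy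
  have key : ∀ i, |x i - y i| ≤ 1 := fun i =>
    (Finset.single_le_sum (f := fun i => |x i - y i|) (fun j _ => abs_nonneg _)
      (Finset.mem_univ i)).trans_eq hy'
  refine ⟨fun i => ?_, fun i => ?_⟩ <;>
  · have := abs_le.mp (key i)
    simp only [Pi.sub_apply, Pi.add_apply, Pi.one_apply]
    omega

instance (d : ℕ) : (lattice d).LocallyFinite :=
  fun x => (lattice_neighborSet_finite d x).fintype

/-- An environment: a conductance in `[0, 1]` on each non-oriented nearest-neighbour edge
of `ℤ^d`. The space of environments carries the product `σ`-algebra. -/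
abbrev Env (d : ℕ) : Type := (lattice d).edgeSet → unitInterval

open Classical in
/-- The conductance `ω(x, y)` of a pair of vertices (`0` if they are not neighbours).
This is also the reversible kernel `μ^ω(x, y) = m^ω(x) p^ω(x, y)` of the random walk. -/
def conductance {d : ℕ} (ω : Env d) (x y : Fin d → ℤ) : ℝ :=
  if h : (lattice d).Adj x y then (ω ⟨s(x, y), h⟩ : ℝ) else 0

/-- The reversible measure `m^ω(x) = ∑_{z ∼ x} ω(x, z)` of a vertex. -/
def vertexMass {d : ℕ} (ω : Env d) (x : Fin d → ℤ) : ℝ :=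
  ∑ z ∈ (lattice d).neighborFinset x, conductance ω x z

/-- The volume `m^ω(A) = ∑_{x ∈ A} m^ω(x)` of a finite set. -/
def mass {d : ℕ} (ω : Env d) (A : Finset (Fin d → ℤ)) : ℝ :=
  ∑ x ∈ A, vertexMass ω x

open Classical in
/-- The edge boundary of `A`: the pairs `(x, y)` of neighbours with `x ∈ A`, `y ∉ A` and
`ω(x, y) > 0`. -/
def boundary {d : ℕ} (ω : Env d) (A : Finset (Fin d → ℤ)) :
    Finset (Σ _ : Fin d → ℤ, Fin d → ℤ) :=
  A.sigma fun x => {y ∈ (lattice d).neighborFinset x | y ∉ A ∧ 0 < conductance ω x y}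

/-- The surface measure `μ^ω(∂A)`, the sum of the conductances over the boundary of `A`. -/
def boundaryMass {d : ℕ} (ω : Env d) (A : Finset (Fin d → ℤ)) : ℝ :=
  ∑ e ∈ boundary ω A, conductance ω e.1 e.2

end RandomConductance

end

namespace RandomConductance

open Finset

/-! This is a Peierls argument. Fill the holes of `A` to get `D ⊇ A`, connected with connected
complement. Every boundary edge of `D` is a boundary edge of `A`, so it suffices to bound below the
conductance through the boundary of `D`. By the lattice isoperimetric inequality that boundary has
at least `#D ^ (1 - 1/d)` edges, and at least half of them turn out to have conductance at least
`ε`.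

Counting makes this uniform in `A`. The base points of the boundary edges form a `*`-connected set
`X` (`exists_close_of_boundaryBase_cut`), because closed 1-cochains on `ℤ^d` are exact. If `#X = n`,
then `X` is the support of a walk of `2 n - 2` steps, and it meets a fixed axis at distance less
than `(d n)^2` from `0`. So there are at most exponentially many candidates for `X`. For small `ε`,
the probability that a given candidate carries at least `n / 2` edges of conductance below `ε` is
exponentially smaller, and Borel–Cantelli excludes all large `n` almost surely. Finally `mass ω A ≤
3 ^ d * #A` turns cardinality into mass. -/

/-- The `i`-th standard basis vector of `ℤ^d`. -/
abbrev basisVec {d : ℕ} (i : Fin d) : Fin d → ℤ := Pi.single i 1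

/-! ### Lattice steps and exactness of closed 1-cochains -/

/-- An equivalence relation that is preserved by unit steps in the directions of `S` relates points
that differ only in the coordinates of `S`. -/
theorem rel_piecewise {d : ℕ} {r : (Fin d → ℤ) → (Fin d → ℤ) → Prop} (hr : Equivalence r)
    (S : Finset (Fin d)) (x z : Fin d → ℤ)
    (h : ∀ y : Fin d → ℤ, (∀ i ∉ S, y i = x i) → ∀ i ∈ S, r y (y + basisVec i)) :
    r x (S.piecewise z x) := by
  suffices H : ∀ T : Finset (Fin d), T ⊆ S → r x (T.piecewise z x) from H S subset_rfl
  intro T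
  induction T using Finset.induction_on with
  | empty => intro _; simpa using hr.refl x
  | insert a T ha ih =>
    intro hT
    have haS : a ∈ S := hT (mem_insert_self a T)
    have hTS : T ⊆ S := fun i hi => hT (mem_insert_of_mem hi)
    refine hr.trans (ih hTS) ?_
    rw [Finset.piecewise_insert]
    set y := T.piecewise z x with hy
    have hyx : ∀ t : ℤ, ∀ i ∉ S, Function.update y a t i = x i := by
      intro t i hi
      have h1 : i ≠ a := by rintro rfl; exact hi haS
      have h2 : i ∉ T := fun h => hi (hTS h)
      simp [h1, hy, h2]
    have hstep : ∀ t : ℤ, r (Function.update y a t) (Function.update y a (t + 1)) := by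
      intro t
      have := h _ (hyx t) a haS
      convert this using 1
      ext i
      by_cases hi : i = a
      · subst hi; simp
      · simp [hi]
    have hline : ∀ t : ℤ, r (Function.update y a 0) (Function.update y a t) := by
      intro t
      induction t using Int.induction_on with
      | zero => exact hr.refl _
      | succ n ih => exact hr.trans ih (hstep _)
      | pred n ih =>
        refine hr.trans ih (hr.symm ?_)
        simpa using hstep (-(n : ℤ) - 1)
    have h1 := hline (y a)
    rw [Function.update_eq_self] at h1
    exact hr.trans (hr.symm h1) (hline _)

/-- An equivalence relation on `ℤ^d` that is preserved by all unit steps is trivial. -/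
theorem rel_of_forall_step {d : ℕ} {r : (Fin d → ℤ) → (Fin d → ℤ) → Prop} (hr : Equivalence r)
    (h : ∀ y i, r y (y + basisVec i)) (x z : Fin d → ℤ) : r x z := by
  simpa using rel_piecewise hr univ x z fun y _ i _ => h y i

/-- Closed integer 1-cochains on `ℤ^d` are exact. -/
theorem exists_potential {d : ℕ} (f : Fin d → (Fin d → ℤ) → ℤ)
    (hf : ∀ i j x, f i x + f j (x + basisVec i) = f j x + f i (x + basisVec j)) :
    ∃ g : (Fin d → ℤ) → ℤ, ∀ i x, g (x + basisVec i) = g x + f i x := by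
  -- Lift each unit shift to `ℤ^d × ℤ`, adding `f i` to the height. Closedness says that the lifts
  -- commute, so they generate an action of `ℤ^d`; the height of the orbit of `(0, 0)` above `x` is
  -- the potential.
  let T : Fin d → Equiv.Perm ((Fin d → ℤ) × ℤ) := fun i =>
    { toFun := fun p => (p.1 + basisVec i, p.2 + f i p.1)
      invFun := fun p => (p.1 - basisVec i, p.2 - f i (p.1 - basisVec i))
      left_inv := fun p => by simp
      right_inv := fun p => by simp }
  have hcomm : ∀ i j, Commute (T i) (T j) := by
    intro i j
    refine Equiv.ext fun p => Prod.ext ?_ ?_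
    · change p.1 + basisVec j + basisVec i = p.1 + basisVec i + basisVec j
      abel
    · change p.2 + f j p.1 + f i (p.1 + basisVec j) = p.2 + f i p.1 + f j (p.1 + basisVec i)
      linarith [hf i j p.1]
  let φ := MonoidHom.noncommPiCoprod (fun i => zpowersHom (Equiv.Perm ((Fin d → ℤ) × ℤ)) (T i))
    (fun i j _ x y => by
      simpa using (hcomm i j).zpow_zpow _ _)
  let m : (Fin d → ℤ) → (Fin d → Multiplicative ℤ) := fun x i => Multiplicative.ofAdd (x i)
  have hφ : ∀ x i, φ (m (x + basisVec i)) = T i * φ (m x) := by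
    intro x i
    have h1 : m (x + basisVec i) = Pi.mulSingle i (Multiplicative.ofAdd 1) * m x := by
      ext j
      by_cases hj : j = i
      · subst hj; simp [m, add_comm]
      · simp [m, hj]
    have h2 : φ (Pi.mulSingle i (Multiplicative.ofAdd 1)) = T i :=
      (MonoidHom.noncommPiCoprod_mulSingle _ _ _).trans (by simp)
    rw [h1, map_mul, h2]
  have hfst : ∀ x, (φ (m x) (0, 0)).1 = x := by
    have key := rel_of_forall_step
      (r := fun x y => (φ (m x) (0, 0)).1 - x = (φ (m y) (0, 0)).1 - y)
      ⟨fun _ => rfl, fun h => h.symm, fun h h' => h.trans h'⟩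
      (fun y i => by
        rw [hφ]
        change _ = (φ (m y) (0, 0)).1 + basisVec i - (y + basisVec i)
        abel)
    intro x
    have h0 : φ (m 0) = 1 := map_one φ
    have := key x 0
    rw [h0] at this
    exact sub_eq_zero.mp (by simpa using this)
  refine ⟨fun x => (φ (m x) (0, 0)).2, fun i x => ?_⟩
  simp only [hφ]
  change (φ (m x) (0, 0)).2 + f i (φ (m x) (0, 0)).1 = _
  rw [hfst]

theorem lattice_adj_add_basisVec {d : ℕ} (x : Fin d → ℤ) (i : Fin d) :
    (lattice d).Adj x (x + basisVec i) := by
  change ∑ j, |x j - (x + basisVec i) j| = 1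
  rw [Finset.sum_eq_single i] <;> simp +contextual

theorem exists_basisVec_of_adj {d : ℕ} {x y : Fin d → ℤ} (h : (lattice d).Adj x y) :
    ∃ i, y = x + basisVec i ∨ x = y + basisVec i := by
  have h' : ∑ i, |x i - y i| = 1 := h
  obtain ⟨i, -, hi⟩ : ∃ i ∈ (univ : Finset (Fin d)), |x i - y i| ≠ 0 := by
    by_contra! hc
    rw [Finset.sum_eq_zero hc] at h'
    omega
  have hsum := Finset.add_sum_erase univ (fun i => |x i - y i|) (mem_univ i)
  simp only [h'] at hsum
  have hnn : 0 ≤ ∑ j ∈ univ.erase i, |x j - y j| := sum_nonneg fun _ _ => abs_nonneg _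
  have hpos : 0 < |x i - y i| := lt_of_le_of_ne (abs_nonneg _) hi.symm
  have hz : ∑ j ∈ univ.erase i, |x j - y j| = 0 := by omega
  have h1 : |x i - y i| = 1 := by omega
  have hj : ∀ j, j ≠ i → x j = y j := by
    intro j hj
    have := (sum_eq_zero_iff_of_nonneg (fun _ _ => abs_nonneg _)).mp hz j (by simp [hj])
    simpa [sub_eq_zero] using this
  refine ⟨i, ?_⟩
  rcases (abs_eq zero_le_one).mp h1 with h2 | h2
  · right
    ext j
    by_cases hji : j = i
    · subst hji; simp; omega
    · simp [hji, hj j hji]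
  · left
    ext j
    by_cases hji : j = i
    · subst hji; simp; omega
    · simp [hji, hj j hji]

/-! ### Filling holes -/

/-- A set on which every function that is constant along lattice edges is constant. -/
def CochainConnected {d : ℕ} (S : Set (Fin d → ℤ)) : Prop :=
  ∀ g : (Fin d → ℤ) → ℤ, (∀ x y, x ∈ S → y ∈ S → (lattice d).Adj x y → g x = g y) →
    ∀ x y, x ∈ S → y ∈ S → g x = g y

/-- A finite set `A` can be enlarged to a finite set `D` by filling its holes: the complement of
`D` is connected, and the inner boundary of `D` lies in `A`. -/
theorem exists_filled {d : ℕ} (hd : 2 ≤ d) (A : Finset (Fin d → ℤ)) :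
    ∃ D : Finset (Fin d → ℤ), A ⊆ D ∧
      (∀ x ∈ D, ∀ y ∉ D, (lattice d).Adj x y → x ∈ A) ∧
      CochainConnected {x | x ∉ D} := by
  classical
  obtain ⟨R, hR⟩ : ∃ R : ℤ, ∀ x ∈ A, ∀ i, |x i| ≤ R := by
    refine ⟨∑ x ∈ A, ∑ i, |x i|, fun x hx i => ?_⟩
    exact (single_le_sum (f := fun i => |x i|) (fun _ _ => abs_nonneg _) (mem_univ i)).trans
      (single_le_sum (f := fun x : Fin d → ℤ => ∑ i, |x i|)
        (fun _ _ => sum_nonneg fun _ _ => abs_nonneg _) hx)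
  let s : (Fin d → ℤ) → (Fin d → ℤ) → Prop := fun x y => (lattice d).Adj x y ∧ x ∉ A ∧ y ∉ A
  let r := Relation.EqvGen s
  have hr : Equivalence r := Relation.EqvGen.is_equivalence s
  let z : Fin d → ℤ := fun _ => R + 1
  have hfar : ∀ x : Fin d → ℤ, ∀ i, R < |x i| → x ∉ A :=
    fun x i hi hx => absurd (hR x hx i) (not_le.mpr hi)
  have hfix : ∀ (x : Fin d → ℤ) (i : Fin d), R < |x i| → ∀ S : Finset (Fin d), i ∉ S →
      r x (S.piecewise z x) := by
    intro x i hi S hS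
    refine rel_piecewise hr S x z fun y hy j hj => Relation.EqvGen.rel _ _
      ⟨lattice_adj_add_basisVec y j, hfar y i (by rwa [hy i hS]), hfar _ i ?_⟩
    have hij : i ≠ j := by rintro rfl; exact hS hj
    simpa [hij, hy i hS] using hi
  -- This is where `2 ≤ d` enters. While `|x i| > R` keeps the path off `A`, another coordinate `j`
  -- is moved to `R + 1`; then `j` keeps it off `A` while all other coordinates are moved.
  have hz : ∀ x : Fin d → ℤ, ∀ i, R < |x i| → r x z := by
    intro x i hi
    obtain ⟨j, hj⟩ : ∃ j : Fin d, j ≠ i := by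
      have : Nontrivial (Fin d) := Fin.nontrivial_iff_two_le.mpr hd
      exact exists_ne i
    have h1 := hfix x i hi {j} (by simpa using hj.symm)
    have hRpos : R < |R + 1| := lt_of_lt_of_le (by omega) (le_abs_self _)
    have h2 := hfix (({j} : Finset (Fin d)).piecewise z x) j (by simpa [z] using hRpos)
      (univ.erase j) (by simp)
    refine hr.trans h1 (by
      convert h2 using 1
      ext k
      by_cases hk : k = j
      · subst hk; simp
      · simp [hk])
  -- `D` consists of `A` and of the points that cannot be joined to the far point `z` outside `A`.
  have hfin : {x | x ∈ A ∨ ¬ r x z}.Finite := by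
    refine (Set.finite_Icc (fun _ : Fin d => -R) (fun _ => R)).subset fun x hx => ?_
    have : ∀ i, |x i| ≤ R := by
      rcases hx with hx | hx
      · exact hR x hx
      · intro i
        by_contra! hc
        exact hx (hz x i hc)
    exact ⟨fun i => (abs_le.mp (this i)).1, fun i => (abs_le.mp (this i)).2⟩
  have hmem : ∀ x, x ∈ hfin.toFinset ↔ x ∈ A ∨ ¬ r x z := fun x => by simp
  refine ⟨hfin.toFinset, fun x hx => (hmem x).mpr (Or.inl hx), ?_, ?_⟩
  · intro x hx y hy hxy
    rw [hmem] at hx hy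
    push Not at hy
    rcases hx with hx | hx
    · exact hx
    · by_contra hxA
      exact hx (hr.trans (Relation.EqvGen.rel _ _ ⟨hxy, hxA, hy.1⟩) hy.2)
  · intro g hg
    have hs : ∀ x y, r x y → r y z → g x = g y := by
      intro x y hxy
      induction hxy with
      | rel x y h =>
        intro hyz
        refine hg x y ?_ ?_ h.1
        · rw [Set.mem_ofPred_eq, hmem]; push Not; exact ⟨h.2.1, hr.trans (Relation.EqvGen.rel _ _ h) hyz⟩
        · rw [Set.mem_ofPred_eq, hmem]; push Not; exact ⟨h.2.2, hyz⟩
      | refl => intro _; rfl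
      | symm x y h ih => intro hxz; exact (ih (hr.trans (hr.symm h) hxz)).symm
      | trans x y w h1 h2 ih1 ih2 =>
        intro hwz
        exact (ih1 (hr.trans h2 hwz)).trans (ih2 hwz)
    intro x y hx hy
    rw [Set.mem_ofPred_eq, hmem] at hx hy
    push Not at hx hy
    rw [hs x z hx.2 (hr.refl _), hs y z hy.2 (hr.refl _)]

theorem cochainConnected_of_connected {d : ℕ} {S : Set (Fin d → ℤ)}
    (hS : ((lattice d).induce S).Connected) : CochainConnected S := by
  intro g hg x y hx hy
  obtain ⟨p⟩ := hS.preconnected ⟨x, hx⟩ ⟨y, hy⟩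
  have : ∀ u v : S, ((lattice d).induce S).Walk u v → g u = g v := by
    intro u v p
    induction p with
    | nil => rfl
    | cons h _ ih => exact (hg _ _ (Subtype.coe_prop _) (Subtype.coe_prop _) h).trans ih
  exact this _ _ p

/-- Filling holes of a connected set gives a connected set. -/
theorem cochainConnected_of_filled {d : ℕ} {A D : Finset (Fin d → ℤ)} (hAD : A ⊆ D)
    (hA : CochainConnected {x | x ∈ A}) {o : Fin d → ℤ} (ho : o ∈ A)
    (hD : ∀ x ∈ D, ∀ y ∉ D, (lattice d).Adj x y → x ∈ A) : CochainConnected {x | x ∈ D} := by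
  intro g hg
  have hgA := hA g fun x y hx hy => hg x y (hAD hx) (hAD hy)
  suffices H : ∀ x ∈ D, g x = g o by
    intro x y hx hy
    rw [H x hx, H y hy]
  by_contra! hc
  obtain ⟨x, hxD, hx⟩ := hc
  -- A point of `D` where `g` differs from `g o` cannot have a neighbour outside `D`, since it would
  -- then lie in `A`. So `P` spreads to the whole lattice, including `o`.
  let P : (Fin d → ℤ) → Prop := fun y => y ∈ D ∧ g y ≠ g o
  have hP : ∀ y w, (lattice d).Adj y w → P y → P w := by
    rintro y w hyw ⟨hyD, hy⟩
    by_cases hw : w ∈ D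
    · exact ⟨hw, by rwa [← hg y w hyD hw hyw]⟩
    · exact absurd (hgA y o (hD y hyD w hw hyw) ho) hy
  have := rel_of_forall_step (r := fun y w => P y ↔ P w)
    ⟨fun _ => Iff.rfl, fun h => h.symm, fun h h' => h.trans h'⟩
    (fun y i => ⟨hP _ _ (lattice_adj_add_basisVec y i),
      hP _ _ (lattice_adj_add_basisVec y i).symm⟩) x o
  exact (this.mp ⟨hxD, hx⟩).2 rfl

/-! ### The edge boundary and its `*`-connectedness -/

/-- The lattice edges `(x, x + e_i)`, encoded as pairs `(x, i)`, with exactly one endpoint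
in `D`. -/
def latticeBoundary {d : ℕ} (D : Finset (Fin d → ℤ)) : Finset ((Fin d → ℤ) × Fin d) :=
  {p ∈ (D ∪ univ.biUnion fun i => D.image (· - basisVec i)) ×ˢ univ |
    ¬ (p.1 ∈ D ↔ p.1 + basisVec p.2 ∈ D)}

theorem mem_latticeBoundary {d : ℕ} {D : Finset (Fin d → ℤ)} {p : (Fin d → ℤ) × Fin d} :
    p ∈ latticeBoundary D ↔ ¬ (p.1 ∈ D ↔ p.1 + basisVec p.2 ∈ D) := by
  simp only [latticeBoundary, mem_filter, mem_product, mem_union, mem_biUnion, mem_image, mem_univ,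
    true_and, and_true, and_iff_right_iff_imp]
  intro h
  by_cases hp : p.1 ∈ D
  · exact Or.inl hp
  · refine Or.inr ⟨p.2, p.1 + basisVec p.2, by tauto, by simp⟩

/-- The base points of the boundary edges of `D`. -/
def boundaryBase {d : ℕ} (D : Finset (Fin d → ℤ)) : Finset (Fin d → ℤ) :=
  (latticeBoundary D).image Prod.fst

theorem mem_boundaryBase {d : ℕ} {D : Finset (Fin d → ℤ)} {x : Fin d → ℤ} :
    x ∈ boundaryBase D ↔ ∃ i, ¬ (x ∈ D ↔ x + basisVec i ∈ D) := by
  simp [boundaryBase, mem_latticeBoundary]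

theorem abs_basisVec_sub_le {d : ℕ} (i j k : Fin d) :
    |(basisVec i : Fin d → ℤ) k - (basisVec j : Fin d → ℤ) k| ≤ 1 := by
  simp only [Pi.single_apply]
  split_ifs <;> simp

theorem abs_basisVec_le {d : ℕ} (i k : Fin d) : |(basisVec i : Fin d → ℤ) k| ≤ 1 := by
  simp only [Pi.single_apply]
  split_ifs <;> simp

/-- The boundary of a connected set with connected complement is `*`-connected. -/
theorem exists_close_of_boundaryBase_cut {d : ℕ} {D : Finset (Fin d → ℤ)}
    (hin : CochainConnected {x | x ∈ D}) (hout : CochainConnected {x | x ∉ D})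
    {T : Finset (Fin d → ℤ)} (hT : T ⊆ boundaryBase D) (hne : T.Nonempty)
    (hT' : T ≠ boundaryBase D) :
    ∃ a ∈ T, ∃ b ∈ boundaryBase D, b ∉ T ∧ ∀ k, |b k - a k| ≤ 1 := by
  classical
  by_contra! hc
  let χ : (Fin d → ℤ) → ℤ := fun x => if x ∈ D then 1 else 0
  let F : Fin d → (Fin d → ℤ) → ℤ := fun i x => χ (x + basisVec i) - χ x
  -- `F` is the coboundary of the indicator of `D`, and `f` keeps only its part based in `T`. If no
  -- other boundary base point is close to `T`, then `f` is still closed: the base points of the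
  -- edges of a unit square are within sup-distance `1` of each other, so on each square `f` either
  -- equals `F` or vanishes.
  let f : Fin d → (Fin d → ℤ) → ℤ := fun i x => if x ∈ T then F i x else 0
  have hF0 : ∀ i x, x ∉ boundaryBase D → F i x = 0 := by
    intro i x hx
    rw [mem_boundaryBase] at hx
    push Not at hx
    simp [F, χ, hx i]
  have hFclosed : ∀ i j x, F i x + F j (x + basisVec i) = F j x + F i (x + basisVec j) := by
    intro i j x
    simp only [F, add_right_comm x (basisVec i) (basisVec j)]
    ring
  have hfF : ∀ a ∈ T, ∀ b, (∀ k, |b k - a k| ≤ 1) → ∀ i, f i b = F i b := by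
    intro a ha b hb i
    by_cases hbT : b ∈ T
    · simp [f, hbT]
    · have hbX : b ∉ boundaryBase D := by
        intro hbX
        obtain ⟨k, hk⟩ := hc a ha b hbX hbT
        exact absurd (hb k) (not_le.mpr hk)
      simp [f, hbT, hF0 i b hbX]
  obtain ⟨g, hg⟩ := exists_potential f (by
    intro i j x
    by_cases hx : x ∈ T
    · rw [hfF x hx x (by simp) i, hfF x hx x (by simp) j,
        hfF x hx (x + basisVec i) (fun k => by simpa using abs_basisVec_le i k) j,
        hfF x hx (x + basisVec j) (fun k => by simpa using abs_basisVec_le j k) i, hFclosed]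
    by_cases hi : x + basisVec i ∈ T
    · rw [hfF _ hi x (fun k => by simpa using abs_basisVec_le i k) i,
        hfF _ hi x (fun k => by simpa using abs_basisVec_le i k) j,
        hfF _ hi _ (by simp) j,
        hfF _ hi (x + basisVec j) (fun k => by simpa using abs_basisVec_sub_le j i k) i, hFclosed]
    by_cases hj : x + basisVec j ∈ T
    · rw [hfF _ hj x (fun k => by simpa using abs_basisVec_le j k) i,
        hfF _ hj x (fun k => by simpa using abs_basisVec_le j k) j,
        hfF _ hj _ (by simp) i,
        hfF _ hj (x + basisVec i) (fun k => by simpa using abs_basisVec_sub_le i j k) j, hFclosed]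
    simp [f, hx, hi, hj])
  have hstep : ∀ x i, (x ∈ D ↔ x + basisVec i ∈ D) → g x = g (x + basisVec i) := by
    intro x i h
    have : f i x = 0 := by simp [f, F, χ, h]
    rw [hg, this, add_zero]
  have hadj : ∀ x y, (x ∈ D ↔ y ∈ D) → (lattice d).Adj x y → g x = g y := by
    intro x y h hxy
    obtain ⟨i, rfl | rfl⟩ := exists_basisVec_of_adj hxy
    · exact hstep _ i h
    · exact (hstep _ i h.symm).symm
  have hginD := hin g fun x y hx hy => hadj x y (iff_of_true hx hy)
  have hgoutD := hout g fun x y hx hy => hadj x y (iff_of_false hx hy)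
  obtain ⟨a, ha⟩ := hne
  obtain ⟨b, hb, hbT⟩ : ∃ b ∈ boundaryBase D, b ∉ T := by
    by_contra! h
    exact hT' (subset_antisymm hT h)
  obtain ⟨i, hi⟩ := mem_boundaryBase.mp (hT ha)
  obtain ⟨j, hj⟩ := mem_boundaryBase.mp hb
  have h1 : g (a + basisVec i) = g a + F i a := by rw [hg]; simp [f, ha]
  have h2 : g (b + basisVec j) = g b := by rw [hg]; simp [f, hbT]
  have hne : g (a + basisVec i) ≠ g a := by
    rw [h1]
    by_cases h : a ∈ D
    · have h' : a + basisVec i ∉ D := by tauto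
      simp [F, χ, h, h']
    · have h' : a + basisVec i ∈ D := by tauto
      simp [F, χ, h, h']
  apply hne
  -- The potential `g` is constant on `D` and on its complement. The edge at `b` has increment `0`
  -- and identifies the two constants, whereas the edge at `a` has increment `±1`.
  have key : ∀ u v, u ∈ D → v ∉ D → g u = g v := by
    intro u v hu hv
    by_cases h : b ∈ D
    · have h' : b + basisVec j ∉ D := by tauto
      rw [hginD u b hu h, ← h2, hgoutD _ v h' hv]
    · have h' : b + basisVec j ∈ D := by tauto
      rw [hginD u _ hu h', h2, hgoutD _ v h hv]
  by_cases h : a ∈ D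
  · exact (key _ _ h (by tauto)).symm
  · exact key _ _ (by tauto) h

/-! ### Isoperimetry in the lattice -/

/-- On every line through a point of a finite set there is a last point. -/
theorem exists_last {d : ℕ} (D : Finset (Fin d → ℤ)) (x : Fin d → ℤ) (hx : x ∈ D) (i : Fin d) :
    ∃ k : ℕ, (∀ j ≤ k, x + j • basisVec i ∈ D) ∧ x + (k + 1) • basisVec i ∉ D := by
  classical
  have hinj : Function.Injective fun k : ℕ => x + k • (basisVec i : Fin d → ℤ) := by
    intro k l h
    have := congrFun h i
    simpa using this
  have hex : ∃ k : ℕ, x + (k + 1) • basisVec i ∉ D := by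
    by_contra! h
    refine Set.infinite_univ (α := ℕ) (Set.Finite.subset
      (D.finite_toSet.preimage (f := fun k : ℕ => x + (k + 1) • (basisVec i : Fin d → ℤ)) ?_) ?_)
    · exact (hinj.comp (add_left_injective 1)).injOn
    · intro k _; exact h k
  refine ⟨Nat.find hex, fun j hj => ?_, Nat.find_spec hex⟩
  rcases j with _ | j
  · simpa using hx
  · simpa using Nat.find_min hex (show j < Nat.find hex by omega)

/-- The base points of the boundary of a finite set containing `0` meet a coordinate axis not
farther than the cardinality of the set. -/
theorem exists_smul_mem_boundaryBase {d : ℕ} {D : Finset (Fin d → ℤ)} (h0 : 0 ∈ D) (i : Fin d) :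
    ∃ k < #D, k • basisVec i ∈ boundaryBase D := by
  obtain ⟨k, hk, hk'⟩ := exists_last D 0 h0 i
  simp only [zero_add] at hk hk'
  refine ⟨k, ?_, mem_boundaryBase.mpr ⟨i, ?_⟩⟩
  · have hsub : (range (k + 1)).image (fun j => j • (basisVec i : Fin d → ℤ)) ⊆ D := by
      intro y hy
      obtain ⟨j, hj, rfl⟩ := mem_image.mp hy
      exact hk j (by simpa [Nat.lt_succ_iff] using hj)
    have := card_le_card hsub
    rw [card_image_of_injective, card_range] at this
    · omega
    · intro a b h
      simpa using congrFun h i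
  · rw [← succ_nsmul]
    have := hk k le_rfl
    tauto

open MeasureTheory in
/-- The isoperimetric inequality in `ℤ^d`. -/
theorem card_rpow_le_card_latticeBoundary {d : ℕ} (hd : 2 ≤ d) (D : Finset (Fin d → ℤ)) :
    (#D : ℝ) ^ (1 - 1 / (d : ℝ)) ≤ #(latticeBoundary D) := by
  classical
  have hd1 : (1 : ℝ) < d := by exact_mod_cast hd
  have hd0 : (0 : ℝ) < d - 1 := by linarith
  set p : ℝ := d / (d - 1) with hp
  have hconj : Real.HolderConjugate (Fintype.card (Fin d) : ℝ) p := by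
    rw [Fintype.card_fin]
    exact Real.HolderConjugate.conjExponent hd1
  -- Apply the grid-lines inequality (the core of Gagliardo–Nirenberg–Sobolev) to the number of
  -- boundary edges based at each point. Every axis line through a point of `D` carries a boundary
  -- edge, so the integrand on the left is at least `1` on `D`.
  let f : (Fin d → ℤ) → ENNReal := fun x => (#{i | (x, i) ∈ latticeBoundary D} : ℕ)
  have hgrid := lintegral_prod_lintegral_pow_le (fun _ : Fin d => (Measure.count : Measure ℤ)) hconj
    (f := f) (measurable_of_countable f)
  have hpi : ∀ F : (Fin d → ℤ) → ENNReal,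
      ∫⁻ x, F x ∂(Measure.pi fun _ : Fin d => (Measure.count : Measure ℤ)) = ∑' x, F x := by
    intro F
    rw [lintegral_countable']
    simp [Measure.pi_singleton]
  rw [hpi, hpi] at hgrid
  have hline : ∀ x ∈ D, ∀ i, 1 ≤ ∫⁻ t, f (Function.update x i t) ∂(Measure.count : Measure ℤ) := by
    intro x hx i
    obtain ⟨k, hk, hk'⟩ := exists_last D x hx i
    rw [lintegral_count]
    refine le_trans ?_ (ENNReal.le_tsum (x i + k))
    have hu : Function.update x i (x i + k) = x + k • basisVec i := by
      ext j
      by_cases hj : j = i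
      · subst hj; simp
      · simp [hj]
    rw [hu]
    have : 0 < #{j | (x + k • basisVec i, j) ∈ latticeBoundary D} := by
      refine card_pos.mpr ⟨i, ?_⟩
      rw [mem_filter, mem_latticeBoundary]
      have h1 := hk k le_rfl
      rw [succ_nsmul, ← add_assoc] at hk'
      simp only [mem_univ, true_and]
      tauto
    simp only [f]
    exact_mod_cast this
  have hsum : ∑' x, f x = (#(latticeBoundary D) : ℕ) := by
    rw [tsum_eq_sum (s := boundaryBase D)]
    · simp only [f]
      norm_cast
      rw [card_eq_sum_card_image Prod.fst (latticeBoundary D)]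
      refine sum_congr rfl fun x _ => ?_
      refine card_bij (fun i _ => (x, i)) ?_ ?_ ?_
      · intro i hi; simpa using hi
      · intro i _ j _ h; simpa using h
      · rintro ⟨y, i⟩ h
        simp only [mem_filter] at h
        obtain ⟨h, rfl⟩ := h
        exact ⟨i, by simpa using h, rfl⟩
    · intro x hx
      simp only [f, Nat.cast_eq_zero, card_eq_zero, filter_eq_empty_iff]
      intro i _ h
      exact hx (mem_image.mpr ⟨_, h, rfl⟩)
  have hle : (#D : ENNReal) ≤ (#(latticeBoundary D) : ENNReal) ^ p := by
    rw [← hsum]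
    refine le_trans ?_ hgrid
    refine le_trans ?_ (ENNReal.sum_le_tsum D)
    rw [card_eq_sum_ones]
    push_cast
    refine sum_le_sum fun x hx => ?_
    refine one_le_prod'' fun i => ?_
    refine ENNReal.one_le_rpow (hline x hx i) ?_
    rw [Fintype.card_fin]
    positivity
  have hle' : (#D : ℝ) ≤ (#(latticeBoundary D) : ℝ) ^ p := by
    have hp0 : 0 ≤ p := by positivity
    have := ENNReal.toReal_mono (ENNReal.rpow_ne_top_of_nonneg hp0 (ENNReal.natCast_ne_top _)) hle
    rwa [← ENNReal.toReal_rpow, ENNReal.toReal_natCast, ENNReal.toReal_natCast] at this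
  have hq : 0 ≤ 1 - 1 / (d : ℝ) := by
    rw [sub_nonneg, div_le_one (by linarith)]; exact hd1.le
  calc (#D : ℝ) ^ (1 - 1 / (d : ℝ))
      ≤ ((#(latticeBoundary D) : ℝ) ^ p) ^ (1 - 1 / (d : ℝ)) :=
        Real.rpow_le_rpow (Nat.cast_nonneg _) hle' hq
    _ = #(latticeBoundary D) := by
        rw [← Real.rpow_mul (Nat.cast_nonneg _)]
        have : p * (1 - 1 / (d : ℝ)) = 1 := by
          rw [hp]; field_simp
        rw [this, Real.rpow_one]

theorem card_latticeBoundary_le {d : ℕ} (D : Finset (Fin d → ℤ)) :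
    #(latticeBoundary D) ≤ d * #(boundaryBase D) := by
  have h : latticeBoundary D ⊆ boundaryBase D ×ˢ univ := fun p hp =>
    mem_product.mpr ⟨mem_image_of_mem _ hp, mem_univ _⟩
  have := card_le_card h
  rwa [card_product, card_univ, Fintype.card_fin, mul_comm] at this

theorem card_boundaryBase_le {d : ℕ} (D : Finset (Fin d → ℤ)) :
    #(boundaryBase D) ≤ #(latticeBoundary D) := card_image_le

/-- Since `1 - 1/d ≥ 1/2`, isoperimetry gives a bound free of real exponents. It limits the starting
points on the axis to polynomially many, and forces a large `A` to have a large filled boundary. -/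
theorem card_le_sq {d : ℕ} (hd : 2 ≤ d) (D : Finset (Fin d → ℤ)) :
    #D ≤ (d * #(boundaryBase D)) ^ 2 := by
  rcases Nat.eq_zero_or_pos #D with h0 | h0
  · simp [h0]
  have h1 : (1 : ℝ) ≤ #D := by exact_mod_cast h0
  have hd1 : (2 : ℝ) ≤ d := by exact_mod_cast hd
  have h2 : (#D : ℝ) ^ (1 / 2 : ℝ) ≤ (d * #(boundaryBase D) : ℕ) := by
    refine (Real.rpow_le_rpow_of_exponent_le h1 ?_).trans
      ((card_rpow_le_card_latticeBoundary hd D).trans (by exact_mod_cast card_latticeBoundary_le D))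
    have : 1 / (d : ℝ) ≤ 1 / 2 := one_div_le_one_div_of_le (by norm_num) hd1
    linarith
  have h3 : (#D : ℝ) = ((#D : ℝ) ^ (1 / 2 : ℝ)) ^ 2 := by
    rw [← Real.rpow_natCast, ← Real.rpow_mul (Nat.cast_nonneg _)]
    norm_num
  have h4 : (#D : ℝ) ≤ ((d * #(boundaryBase D) : ℕ) : ℝ) ^ 2 :=
    h3.trans_le (pow_le_pow_left₀ (Real.rpow_nonneg (Nat.cast_nonneg _) _) h2 2)
  exact_mod_cast h4

/-! ### Counting `*`-connected sets -/

/-- The supports of the walks with `k` steps of sup-norm at most `1` that start at `v`. -/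
noncomputable def walkSupports {d : ℕ} : ℕ → (Fin d → ℤ) → Finset (Finset (Fin d → ℤ))
  | 0, v => {{v}}
  | k + 1, v => (Icc (v - 1) (v + 1)).biUnion fun u => (walkSupports k u).image (insert v)

theorem card_Icc_sub_one_add_one {d : ℕ} (v : Fin d → ℤ) : #(Icc (v - 1) (v + 1)) = 3 ^ d := by
  rw [Pi.card_Icc]
  have : ∀ i, #(Icc ((v - 1) i) ((v + 1) i)) = 3 := by
    intro i
    rw [Int.card_Icc]
    simp only [Pi.sub_apply, Pi.add_apply, Pi.one_apply]
    omega
  simp only [this, prod_const, card_univ, Fintype.card_fin]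

theorem card_walkSupports_le {d : ℕ} (k : ℕ) (v : Fin d → ℤ) :
    #(walkSupports k v) ≤ (3 ^ d) ^ k := by
  induction k generalizing v with
  | zero => simp [walkSupports]
  | succ k ih =>
    refine (card_biUnion_le_card_mul _ _ _ fun u _ => card_image_le.trans (ih u)).trans ?_
    rw [card_Icc_sub_one_add_one, pow_succ']

theorem toFinset_mem_walkSupports {d : ℕ} (k : ℕ) (v : Fin d → ℤ) (l : List (Fin d → ℤ))
    (hl : l.length = k) (hc : List.IsChain (fun a b => ∀ i, |b i - a i| ≤ 1) (v :: l)) :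
    (v :: l).toFinset ∈ walkSupports k v := by
  induction k generalizing v l with
  | zero =>
    obtain rfl := List.length_eq_zero_iff.mp hl
    simp [walkSupports]
  | succ k ih =>
    obtain _ | ⟨u, l⟩ := l
    · simp at hl
    rw [List.isChain_cons_cons] at hc
    rw [List.toFinset_cons]
    refine mem_biUnion.mpr ⟨u, ?_, mem_image_of_mem _ (ih u l (by simpa using hl) hc.2)⟩
    rw [mem_Icc]
    refine ⟨fun i => ?_, fun i => ?_⟩ <;>
    · have := abs_le.mp (hc.1 i)
      simp only [Pi.sub_apply, Pi.add_apply, Pi.one_apply]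
      omega

/-- A `*`-connected set of `n` points is the support of a walk with `2 n - 2` steps. -/
theorem mem_walkSupports_of_cut {d : ℕ} {X : Finset (Fin d → ℤ)} {v : Fin d → ℤ} (hv : v ∈ X)
    (h : ∀ T ⊆ X, T.Nonempty → T ≠ X → ∃ a ∈ T, ∃ b ∈ X, b ∉ T ∧ ∀ k, |b k - a k| ≤ 1) :
    X ∈ walkSupports (2 * #X - 2) v := by
  -- Each new point `b` close to a visited `a` is added by the detour `a, b, a`, which costs two
  -- steps.
  have key : ∀ m, m + 1 ≤ #X → ∃ l : List (Fin d → ℤ), l.length = 2 * m ∧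
      List.IsChain (fun a b => ∀ i, |b i - a i| ≤ 1) (v :: l) ∧
      (v :: l).toFinset ⊆ X ∧ #(v :: l).toFinset = m + 1 := by
    intro m
    induction m with
    | zero => intro _; exact ⟨[], by simp, by simp, by simpa using hv, by simp⟩
    | succ m ih =>
      intro hm
      obtain ⟨l, hl, hc, hsub, hcard⟩ := ih (by omega)
      obtain ⟨a, ha, b, hbX, hbT, hab⟩ := h _ hsub ⟨v, by simp⟩
        (fun he => by rw [he] at hcard; omega)
      have hba : ∀ i, |a i - b i| ≤ 1 := fun i => by rw [abs_sub_comm]; exact hab i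
      obtain ⟨l₁, l₂, hl₁₂⟩ := List.append_of_mem (List.mem_toFinset.mp ha)
      have hset : (l₁ ++ a :: b :: a :: l₂).toFinset = insert b (v :: l).toFinset := by
        rw [hl₁₂]
        ext y
        simp only [List.mem_toFinset, List.mem_append, List.mem_cons, mem_insert]
        tauto
      have hchain : List.IsChain (fun a b => ∀ i, |b i - a i| ≤ 1) (l₁ ++ a :: b :: a :: l₂) := by
        rw [hl₁₂, List.isChain_split] at hc
        rw [List.isChain_split]
        exact ⟨hc.1, List.isChain_cons_cons.mpr ⟨hab, List.isChain_cons_cons.mpr ⟨hba, hc.2⟩⟩⟩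
      have hlen := congrArg List.length hl₁₂
      simp only [List.length_cons, List.length_append] at hlen
      obtain ⟨l', hl'⟩ : ∃ l', l₁ ++ a :: b :: a :: l₂ = v :: l' := by
        obtain _ | ⟨w, l₁⟩ := l₁
        · simp only [List.nil_append, List.cons.injEq] at hl₁₂
          exact ⟨b :: a :: l₂, by simp [hl₁₂.1]⟩
        · simp only [List.cons_append, List.cons.injEq] at hl₁₂
          exact ⟨l₁ ++ a :: b :: a :: l₂, by simp [hl₁₂.1]⟩
      have hlen' := congrArg List.length hl'
      simp only [List.length_cons, List.length_append] at hlen'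
      refine ⟨l', by omega, by rwa [← hl'], ?_, ?_⟩
      · rw [← hl', hset]
        exact insert_subset hbX hsub
      · rw [← hl', hset, card_insert_of_notMem hbT, hcard]
  have hpos : 0 < #X := card_pos.mpr ⟨v, hv⟩
  obtain ⟨l, hl, hc, hsub, hcard⟩ := key (#X - 1) (by omega)
  have he : (v :: l).toFinset = X := eq_of_subset_of_card_le hsub (by omega)
  rw [← he]
  refine toFinset_mem_walkSupports _ v l ?_ hc
  rw [he]
  omega

/-- The lattice edge from `x` to `x + e_i`. -/
def latticeEdge {d : ℕ} (p : (Fin d → ℤ) × Fin d) : (lattice d).edgeSet :=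
  ⟨s(p.1, p.1 + basisVec p.2), lattice_adj_add_basisVec p.1 p.2⟩

theorem latticeEdge_injective {d : ℕ} : Function.Injective (latticeEdge (d := d)) := by
  rintro ⟨x, i⟩ ⟨y, j⟩ h
  have h' : s(x, x + basisVec i) = s(y, y + basisVec j) := congrArg Subtype.val h
  rw [Sym2.eq_iff] at h'
  rcases h' with ⟨rfl, h2⟩ | ⟨h1, h2⟩
  · have h3 := congrFun (add_left_cancel h2) i
    by_cases hij : i = j
    · rw [hij]
    · simp [hij] at h3
  · exfalso
    have h3 := congrFun h1 i
    have h4 := congrFun h2 i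
    by_cases hij : i = j
    · subst hij
      simp at h3 h4
      omega
    · simp [hij] at h3 h4
      omega

/-! ### Peierls estimate and Borel–Cantelli -/

section Probability

open MeasureTheory ProbabilityTheory

variable {d : ℕ} {Q : Measure (Env d)}

theorem measurableSet_lt_edge (e : (lattice d).edgeSet) (ε : ℝ) :
    MeasurableSet {ω : Env d | (ω e : ℝ) < ε} :=
  measurableSet_lt (measurable_subtype_coe.comp (measurable_pi_apply e)) measurable_const

/-- The probability that at least half of `n` edges are bad among the edges of `U`. -/
theorem measure_many_bad_le [IsProbabilityMeasure Q]
    (hindep : iIndepFun (fun (e : (lattice d).edgeSet) (ω : Env d) => ω e) Q)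
    {ε : ℝ} {η : ENNReal} (hη1 : η ≤ 1) (hη : ∀ e, Q {ω | (ω e : ℝ) < ε} ≤ η ^ 2)
    (U : Finset ((Fin d → ℤ) × Fin d)) (n : ℕ) :
    Q {ω | n ≤ 2 * #{p ∈ U | (ω (latticeEdge p) : ℝ) < ε}} ≤ 2 ^ #U * η ^ n := by
  classical
  have hall : ∀ F : Finset ((Fin d → ℤ) × Fin d),
      Q {ω | ∀ p ∈ F, (ω (latticeEdge p) : ℝ) < ε} ≤ η ^ (2 * #F) := by
    intro F
    have hpre := (hindep.precomp latticeEdge_injective).measure_inter_preimage_eq_mul F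
      (sets := fun _ => {t | (t : ℝ) < ε})
      (fun _ _ => measurableSet_lt measurable_subtype_coe measurable_const)
    have hset : {ω : Env d | ∀ p ∈ F, (ω (latticeEdge p) : ℝ) < ε} =
        ⋂ p ∈ F, (fun ω : Env d => ω (latticeEdge p)) ⁻¹' {t | (t : ℝ) < ε} := by
      ext ω; simp
    rw [hset, hpre, pow_mul]
    refine (prod_le_prod' fun p _ => hη (latticeEdge p)).trans ?_
    simp
  have hsub : {ω : Env d | n ≤ 2 * #{p ∈ U | (ω (latticeEdge p) : ℝ) < ε}} ⊆
      ⋃ F ∈ U.powerset.filter (fun F => n ≤ 2 * #F),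
        {ω | ∀ p ∈ F, (ω (latticeEdge p) : ℝ) < ε} := by
    intro ω hω
    simp only [Set.mem_iUnion]
    refine ⟨{p ∈ U | (ω (latticeEdge p) : ℝ) < ε}, ?_, fun p hp => (mem_filter.mp hp).2⟩
    exact mem_filter.mpr ⟨mem_powerset.mpr (filter_subset _ _), hω⟩
  calc _ ≤ _ := measure_mono hsub
    -- The bound `η ^ 2` per edge compensates for only half of `n` edges being bad: `2 * #F ≥ n`
    -- gives `η ^ (2 * #F) ≤ η ^ n`.
    _ ≤ ∑ F ∈ U.powerset.filter (fun F => n ≤ 2 * #F), η ^ n := by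
        refine (measure_biUnion_finset_le _ _).trans (sum_le_sum fun F hF => (hall F).trans ?_)
        exact pow_le_pow_right_of_le_one' hη1 (mem_filter.mp hF).2
    _ ≤ 2 ^ #U * η ^ n := by
        rw [sum_const, nsmul_eq_mul]
        gcongr
        have := card_filter_le U.powerset (fun F => n ≤ 2 * #F)
        rw [card_powerset] at this
        exact_mod_cast this

/-- Small conductances are uniformly unlikely. -/
theorem exists_threshold [IsProbabilityMeasure Q]
    (hident : ∀ e e' : (lattice d).edgeSet,
      IdentDistrib (fun ω : Env d => ω e) (fun ω : Env d => ω e') Q Q)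
    (hpos : ∀ e : (lattice d).edgeSet, Q {ω : Env d | 0 < ω e} = 1)
    {δ : ENNReal} (hδ : 0 < δ) (e₀ : (lattice d).edgeSet) :
    ∃ ε : ℝ, 0 < ε ∧ ∀ e, Q {ω | (ω e : ℝ) < ε} ≤ δ := by
  have hnull : Q (⋂ n : ℕ, {ω : Env d | (ω e₀ : ℝ) < 1 / ((n : ℝ) + 1)}) = 0 := by
    refine measure_mono_null (t := {ω : Env d | 0 < ω e₀}ᶜ) ?_ ?_
    · intro ω hω hp
      rw [Set.mem_iInter] at hω
      have hp' : (0 : ℝ) < ω e₀ := hp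
      obtain ⟨n, hn⟩ := exists_nat_one_div_lt hp'
      exact absurd (hω n) (not_lt.mpr hn.le)
    · rw [prob_compl_eq_zero_iff (measurableSet_lt measurable_const (measurable_pi_apply e₀))]
      exact hpos e₀
  have hanti : Antitone fun n : ℕ => {ω : Env d | (ω e₀ : ℝ) < 1 / ((n : ℝ) + 1)} := by
    intro m n hmn ω hω
    have : (ω e₀ : ℝ) < 1 / ((n : ℝ) + 1) := hω
    exact this.trans_le (one_div_le_one_div_of_le (by positivity) (by gcongr))
  have hlim := tendsto_measure_iInter_atTop (μ := Q)
    (fun n : ℕ => (measurableSet_lt_edge e₀ (1 / ((n : ℝ) + 1))).nullMeasurableSet) hanti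
    ⟨0, measure_ne_top _ _⟩
  rw [hnull] at hlim
  obtain ⟨n, hn⟩ := (hlim.eventually (gt_mem_nhds hδ)).exists
  refine ⟨1 / ((n : ℝ) + 1), by positivity, fun e => ?_⟩
  have h := (hident e e₀).measure_mem_eq (s := {t | (t : ℝ) < 1 / ((n : ℝ) + 1)})
    (measurableSet_lt measurable_subtype_coe measurable_const)
  exact (h.trans_lt hn).le

/-- The environments for which some walk support of cardinality `n` that starts near `0` has many
bad edges. -/
def badEnvs (d : ℕ) (ε : ℝ) (i : Fin d) (n : ℕ) : Set (Env d) :=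
  ⋃ k ∈ range ((d * n) ^ 2), ⋃ X ∈ (walkSupports (2 * n - 2) (k • basisVec i)).filter (#· = n),
    {ω | n ≤ 2 * #{p ∈ X ×ˢ univ | (ω (latticeEdge p) : ℝ) < ε}}

/-- Union bound: `4 ^ n` absorbs the starting points, `9 ^ (d n)` counts the walks, and `2 ^ (d n)`
counts the sets of bad edges over a support. -/
theorem measure_badEnvs_le [IsProbabilityMeasure Q]
    (hindep : iIndepFun (fun (e : (lattice d).edgeSet) (ω : Env d) => ω e) Q)
    {ε : ℝ} {η : ENNReal} (hη1 : η ≤ 1) (hη : ∀ e, Q {ω | (ω e : ℝ) < ε} ≤ η ^ 2)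
    (i : Fin d) (n : ℕ) :
    Q (badEnvs d ε i n) ≤ d ^ 2 * (4 * 9 ^ d * 2 ^ d * η) ^ n := by
  have h1 : Q (badEnvs d ε i n) ≤ ∑ k ∈ range ((d * n) ^ 2),
      ∑ X ∈ (walkSupports (2 * n - 2) (k • basisVec i)).filter (#· = n),
        (2 ^ (n * d) * η ^ n : ENNReal) := by
    refine (measure_biUnion_finset_le _ _).trans (sum_le_sum fun k _ => ?_)
    refine (measure_biUnion_finset_le _ _).trans (sum_le_sum fun X hX => ?_)
    refine (measure_many_bad_le hindep hη1 hη _ n).trans_eq ?_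
    rw [card_product, (mem_filter.mp hX).2, card_univ, Fintype.card_fin]
  have h2 : ∀ k : ℕ, #((walkSupports (2 * n - 2) (k • (basisVec i : Fin d → ℤ))).filter (#· = n)) ≤
      (9 ^ d) ^ n := by
    intro k
    refine (card_filter_le _ _).trans ((card_walkSupports_le _ _).trans ?_)
    calc (3 ^ d) ^ (2 * n - 2) ≤ (3 ^ d) ^ (2 * n) :=
          Nat.pow_le_pow_right (by positivity) (Nat.sub_le _ _)
      _ = (9 ^ d) ^ n := by
          rw [pow_mul, ← pow_mul 3 d 2, mul_comm d 2, pow_mul 3 2 d]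
          norm_num
  have h3 : (d * n) ^ 2 ≤ d ^ 2 * 4 ^ n := by
    rw [mul_pow]
    refine Nat.mul_le_mul_left _ ?_
    calc n ^ 2 ≤ (2 ^ n) ^ 2 := Nat.pow_le_pow_left Nat.lt_two_pow_self.le 2
      _ = 4 ^ n := by rw [← pow_mul, mul_comm, pow_mul]; norm_num
  calc Q (badEnvs d ε i n)
      ≤ ∑ k ∈ range ((d * n) ^ 2), ((9 ^ d) ^ n * (2 ^ (n * d) * η ^ n) : ENNReal) := by
        refine h1.trans (sum_le_sum fun k _ => ?_)
        rw [sum_const, nsmul_eq_mul]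
        gcongr
        exact_mod_cast h2 k
    _ = (((d * n) ^ 2 : ℕ) : ENNReal) * ((9 ^ d) ^ n * (2 ^ (n * d) * η ^ n)) := by
        rw [sum_const, nsmul_eq_mul, card_range]
    _ ≤ ((d ^ 2 * 4 ^ n : ℕ) : ENNReal) * ((9 ^ d) ^ n * (2 ^ (n * d) * η ^ n)) := by
        gcongr
    _ = _ := by
        push_cast
        rw [mul_pow, mul_pow, mul_pow, mul_comm n d, pow_mul 2 d n]
        ring

theorem exists_ae_eventually_notMem_badEnvs [IsProbabilityMeasure Q]
    (hindep : iIndepFun (fun (e : (lattice d).edgeSet) (ω : Env d) => ω e) Q)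
    (hident : ∀ e e' : (lattice d).edgeSet,
      IdentDistrib (fun ω : Env d => ω e) (fun ω : Env d => ω e') Q Q)
    (hpos : ∀ e : (lattice d).edgeSet, Q {ω : Env d | 0 < ω e} = 1) (i : Fin d) :
    ∃ ε : ℝ, 0 < ε ∧ ∀ᵐ ω ∂Q, ∃ n₁ : ℕ, ∀ n, n₁ < n → ω ∉ badEnvs d ε i n := by
  set c : ENNReal := 4 * 9 ^ d * 2 ^ d with hc
  have hctop : c ≠ ⊤ := by
    have : c = ((4 * 9 ^ d * 2 ^ d : ℕ) : ENNReal) := by push_cast; rfl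
    rw [this]; exact ENNReal.natCast_ne_top _
  have hc1 : 1 ≤ c := by
    have : c = ((4 * 9 ^ d * 2 ^ d : ℕ) : ENNReal) := by push_cast; rfl
    rw [this]; exact_mod_cast Nat.one_le_iff_ne_zero.mpr (by positivity)
  have hc0 : c ≠ 0 := (zero_lt_one.trans_le hc1).ne'
  -- Chosen so that `c * η = 1/2`, which makes the bounds a convergent geometric series.
  set η : ENNReal := c⁻¹ * 2⁻¹ with hη
  have hη1 : η ≤ 1 := mul_le_one' (ENNReal.inv_le_one.mpr hc1) (by simp)
  have hη0 : 0 < η ^ 2 := by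
    refine pos_of_ne_zero (pow_ne_zero _ (mul_ne_zero ?_ ?_)) <;> simp [hctop]
  obtain ⟨ε, hε, hbad⟩ := exists_threshold hident hpos hη0 (latticeEdge (0, i))
  refine ⟨ε, hε, ?_⟩
  have hsum : ∑' n, Q (badEnvs d ε i n) ≠ ⊤ := by
    refine ne_top_of_le_ne_top ?_ (ENNReal.tsum_le_tsum fun n =>
      measure_badEnvs_le hindep hη1 hbad i n)
    have hcη : c * η = 2⁻¹ := by
      rw [hη, ← mul_assoc, ENNReal.mul_inv_cancel hc0 hctop, one_mul]
    rw [← hc, hcη, ENNReal.tsum_mul_left, ENNReal.tsum_geometric]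
    refine ENNReal.mul_ne_top (by simp) ?_
    simp
  filter_upwards [ae_finite_setOfPred_mem hsum] with ω hω
  obtain ⟨n₁, hn₁⟩ := hω.bddAbove
  exact ⟨n₁, fun n hn h => absurd (hn₁ h) (not_le.mpr hn)⟩

end Probability

/-! ### From good environments to the isoperimetric inequality -/

theorem conductance_nonneg {d : ℕ} (ω : Env d) (x y : Fin d → ℤ) : 0 ≤ conductance ω x y := by
  unfold conductance
  split_ifs
  · exact (ω _).2.1
  · exact le_rfl

theorem conductance_le_one {d : ℕ} (ω : Env d) (x y : Fin d → ℤ) : conductance ω x y ≤ 1 := by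
  unfold conductance
  split_ifs
  · exact (ω _).2.2
  · exact zero_le_one

theorem conductance_comm {d : ℕ} (ω : Env d) (x y : Fin d → ℤ) :
    conductance ω x y = conductance ω y x := by
  unfold conductance
  by_cases h : (lattice d).Adj x y
  · rw [dif_pos h, dif_pos h.symm]
    simp only [Sym2.eq_swap]
  · rw [dif_neg h, dif_neg fun h' => h h'.symm]

theorem conductance_add_basisVec {d : ℕ} (ω : Env d) (p : (Fin d → ℤ) × Fin d) :
    conductance ω p.1 (p.1 + basisVec p.2) = ω (latticeEdge p) := by
  unfold conductance
  rw [dif_pos (lattice_adj_add_basisVec p.1 p.2)]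
  rfl

theorem vertexMass_nonneg {d : ℕ} (ω : Env d) (x : Fin d → ℤ) : 0 ≤ vertexMass ω x :=
  sum_nonneg fun _ _ => conductance_nonneg ω _ _

theorem vertexMass_le {d : ℕ} (ω : Env d) (x : Fin d → ℤ) : vertexMass ω x ≤ 3 ^ d := by
  have h1 : vertexMass ω x ≤ ∑ _z ∈ (lattice d).neighborFinset x, (1 : ℝ) :=
    sum_le_sum fun z _ => conductance_le_one ω x z
  have h2 : (lattice d).neighborFinset x ⊆ Icc (x - 1) (x + 1) := by
    intro y hy
    rw [SimpleGraph.mem_neighborFinset] at hy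
    have key : ∀ i, |x i - y i| ≤ 1 := by
      obtain ⟨j, rfl | rfl⟩ := exists_basisVec_of_adj hy <;> intro i <;>
        simpa using abs_basisVec_le j i
    rw [mem_Icc]
    refine ⟨fun i => ?_, fun i => ?_⟩ <;>
    · have := abs_le.mp (key i)
      simp only [Pi.sub_apply, Pi.add_apply, Pi.one_apply]
      omega
  have h3 := card_le_card h2
  rw [card_Icc_sub_one_add_one] at h3
  refine h1.trans ?_
  simp only [sum_const, nsmul_eq_mul, mul_one]
  exact_mod_cast h3

theorem mass_nonneg {d : ℕ} (ω : Env d) (A : Finset (Fin d → ℤ)) : 0 ≤ mass ω A :=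
  sum_nonneg fun _ _ => vertexMass_nonneg ω _

theorem mass_le {d : ℕ} (ω : Env d) (A : Finset (Fin d → ℤ)) : mass ω A ≤ 3 ^ d * #A := by
  refine (sum_le_sum fun x _ => vertexMass_le ω x).trans_eq ?_
  rw [sum_const, nsmul_eq_mul, mul_comm]

/-- The boundary mass of `A` is at least the conductance of the boundary edges of the filled set
`D`. -/
theorem sum_latticeBoundary_le_boundaryMass {d : ℕ} (ω : Env d) {A D : Finset (Fin d → ℤ)}
    (hAD : A ⊆ D) (hD : ∀ x ∈ D, ∀ y ∉ D, (lattice d).Adj x y → x ∈ A) :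
    ∑ p ∈ latticeBoundary D, (ω (latticeEdge p) : ℝ) ≤ boundaryMass ω A := by
  classical
  -- Orient each boundary edge so that it leaves `D`.
  let φ : (Fin d → ℤ) × Fin d → Σ _ : Fin d → ℤ, Fin d → ℤ := fun p =>
    if p.1 ∈ D then ⟨p.1, p.1 + basisVec p.2⟩ else ⟨p.1 + basisVec p.2, p.1⟩
  have hφs : ∀ p, s((φ p).1, (φ p).2) = (latticeEdge p : Sym2 (Fin d → ℤ)) := by
    intro p
    by_cases hp : p.1 ∈ D
    · simp [φ, hp, latticeEdge]
    · simp only [φ, hp, if_false, latticeEdge]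
      exact Sym2.eq_swap
  have hφinj : Function.Injective φ := by
    intro p q h
    apply latticeEdge_injective
    apply Subtype.ext
    rw [← hφs, ← hφs, h]
  have hφc : ∀ p, conductance ω (φ p).1 (φ p).2 = ω (latticeEdge p) := by
    intro p
    rw [← conductance_add_basisVec]
    by_cases hp : p.1 ∈ D
    · simp [φ, hp]
    · simp only [φ, hp, if_false]
      exact conductance_comm _ _ _
  have hφD : ∀ p ∈ latticeBoundary D, (φ p).1 ∈ D ∧ (φ p).2 ∉ D ∧
      (lattice d).Adj (φ p).1 (φ p).2 := by
    intro p hp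
    rw [mem_latticeBoundary] at hp
    by_cases h : p.1 ∈ D
    · simp only [φ, h, if_true]
      exact ⟨trivial, by tauto, lattice_adj_add_basisVec _ _⟩
    · simp only [φ, h, if_false]
      exact ⟨by tauto, not_false, (lattice_adj_add_basisVec _ _).symm⟩
  have hle : ∑ q ∈ ((latticeBoundary D).image φ), conductance ω q.1 q.2 =
      ∑ p ∈ latticeBoundary D, (ω (latticeEdge p) : ℝ) := by
    rw [sum_image fun p _ q _ h => hφinj h]
    exact sum_congr rfl fun p _ => hφc p
  rw [← hle]
  have hfilter : ∑ q ∈ ((latticeBoundary D).image φ) with 0 < conductance ω q.1 q.2,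
      conductance ω q.1 q.2 = ∑ q ∈ ((latticeBoundary D).image φ), conductance ω q.1 q.2 := by
    refine sum_filter_of_ne fun q _ hq => lt_of_le_of_ne (conductance_nonneg _ _ _) hq.symm
  rw [← hfilter]
  refine sum_le_sum_of_subset_of_nonneg ?_ fun _ _ _ => conductance_nonneg _ _ _
  intro q hq
  obtain ⟨hq, hqpos⟩ := mem_filter.mp hq
  obtain ⟨p, hp, rfl⟩ := mem_image.mp hq
  obtain ⟨h1, h2, h3⟩ := hφD p hp
  refine mem_sigma.mpr ⟨hD _ h1 _ h2 h3, mem_filter.mpr ⟨?_, fun h => h2 (hAD h), hqpos⟩⟩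
  exact (SimpleGraph.mem_neighborFinset _ _ _).mpr h3

/-- Outside the bad environments, connected sets with a large filled boundary satisfy the
isoperimetric inequality. -/
theorem boundaryMass_ge_of_notMem_badEnvs {d : ℕ} (hd : 2 ≤ d) {ω : Env d} {ε : ℝ} (hε : 0 < ε)
    {i : Fin d} {n₁ : ℕ} (hω : ∀ n, n₁ < n → ω ∉ badEnvs d ε i n) {A : Finset (Fin d → ℤ)}
    (hA : ((lattice d).induce (A : Set (Fin d → ℤ))).Connected) (h0 : 0 ∈ A)
    (hbig : (d * n₁) ^ 2 < #A) :
    ε / 2 * (#A : ℝ) ^ (1 - 1 / (d : ℝ)) ≤ boundaryMass ω A := by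
  classical
  obtain ⟨D, hAD, hD, hout⟩ := exists_filled hd A
  have hin : CochainConnected {x | x ∈ D} :=
    cochainConnected_of_filled hAD (cochainConnected_of_connected hA) h0 hD
  set n := #(boundaryBase D) with hn
  have hn₁ : n₁ < n := by
    by_contra! hle
    have h1 := (card_le_card hAD).trans (card_le_sq hd D)
    have h2 : (d * #(boundaryBase D)) ^ 2 ≤ (d * n₁) ^ 2 :=
      Nat.pow_le_pow_left (Nat.mul_le_mul_left _ hle) 2
    omega
  obtain ⟨k, hk, hkX⟩ := exists_smul_mem_boundaryBase (hAD h0) i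
  have hX := mem_walkSupports_of_cut hkX fun T hT hne hT' =>
    exists_close_of_boundaryBase_cut hin hout hT hne hT'
  have hfew : 2 * #{p ∈ boundaryBase D ×ˢ univ | (ω (latticeEdge p) : ℝ) < ε} < n := by
    by_contra! hle
    refine hω n hn₁ ?_
    simp only [badEnvs, Set.mem_iUnion]
    exact ⟨k, mem_range.mpr (hk.trans_le (card_le_sq hd D)), _, mem_filter.mpr ⟨hX, rfl⟩, hle⟩
  -- Fewer than `n / 2` edges are bad and the boundary has at least `n` edges, so at least half of
  -- the boundary edges are good.
  have hsplit := card_filter_add_card_filter_not (s := latticeBoundary D)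
    (fun p => (ω (latticeEdge p) : ℝ) < ε)
  have hbad : #{p ∈ latticeBoundary D | (ω (latticeEdge p) : ℝ) < ε} ≤
      #{p ∈ boundaryBase D ×ˢ univ | (ω (latticeEdge p) : ℝ) < ε} :=
    card_le_card (filter_subset_filter _ fun p hp =>
      mem_product.mpr ⟨mem_image_of_mem _ hp, mem_univ _⟩)
  have hnle := card_boundaryBase_le D
  have hgood : #(latticeBoundary D) ≤
      2 * #{p ∈ latticeBoundary D | ¬ (ω (latticeEdge p) : ℝ) < ε} := by omega
  have hgood' : (#(latticeBoundary D) : ℝ) ≤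
      2 * #{p ∈ latticeBoundary D | ¬ (ω (latticeEdge p) : ℝ) < ε} := by exact_mod_cast hgood
  have hsum : ε * #{p ∈ latticeBoundary D | ¬ (ω (latticeEdge p) : ℝ) < ε} ≤
      ∑ p ∈ latticeBoundary D, (ω (latticeEdge p) : ℝ) := by
    calc _ = ∑ p ∈ latticeBoundary D with ¬ (ω (latticeEdge p) : ℝ) < ε, ε := by
          rw [sum_const, nsmul_eq_mul, mul_comm]
      _ ≤ ∑ p ∈ latticeBoundary D with ¬ (ω (latticeEdge p) : ℝ) < ε, (ω (latticeEdge p) : ℝ) :=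
          sum_le_sum fun p hp => not_lt.mp (mem_filter.mp hp).2
      _ ≤ _ := sum_le_sum_of_subset_of_nonneg (filter_subset _ _) fun p _ _ => (ω _).2.1
  have hiso : (#A : ℝ) ^ (1 - 1 / (d : ℝ)) ≤ #(latticeBoundary D) := by
    refine (Real.rpow_le_rpow (Nat.cast_nonneg _) (by exact_mod_cast card_le_card hAD) ?_).trans
      (card_rpow_le_card_latticeBoundary hd D)
    have hd1 : (1 : ℝ) ≤ d := by exact_mod_cast (by omega : 1 ≤ d)
    rw [sub_nonneg, div_le_one (by linarith)]
    exact hd1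
  calc ε / 2 * (#A : ℝ) ^ (1 - 1 / (d : ℝ)) ≤ ε / 2 * #(latticeBoundary D) := by gcongr
    _ ≤ ε / 2 * (2 * #{p ∈ latticeBoundary D | ¬ (ω (latticeEdge p) : ℝ) < ε}) := by gcongr
    _ = ε * #{p ∈ latticeBoundary D | ¬ (ω (latticeEdge p) : ℝ) < ε} := by ring
    _ ≤ _ := hsum.trans (sum_latticeBoundary_le_boundaryMass ω hAD hD)

end RandomConductance

theorem mainTheorem5 (d : ℕ) (hd : 2 ≤ d)
    (Q : MeasureTheory.Measure (RandomConductance.Env d))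
    [MeasureTheory.IsProbabilityMeasure Q]
    (hindep : ProbabilityTheory.iIndepFun
      (fun (e : (RandomConductance.lattice d).edgeSet) (ω : RandomConductance.Env d) => ω e) Q)
    (hident : ∀ e e' : (RandomConductance.lattice d).edgeSet,
      ProbabilityTheory.IdentDistrib
        (fun ω : RandomConductance.Env d => ω e) (fun ω : RandomConductance.Env d => ω e') Q Q)
    (hpos : ∀ e : (RandomConductance.lattice d).edgeSet,
      Q {ω : RandomConductance.Env d | 0 < ω e} = 1) :
    ∃ β₀ : ℝ, 0 < β₀ ∧ ∀ᵐ ω ∂Q, ∃ N₀ : ℕ, ∀ A : Finset (Fin d → ℤ),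
      ((RandomConductance.lattice d).induce (A : Set (Fin d → ℤ))).Connected →
      (0 : Fin d → ℤ) ∈ A →
      (N₀ : ℝ) ≤ RandomConductance.mass ω A →
      β₀ * RandomConductance.mass ω A ^ (1 - 1 / (d : ℝ)) ≤
        RandomConductance.boundaryMass ω A := by
  obtain ⟨ε, hε, hae⟩ := RandomConductance.exists_ae_eventually_notMem_badEnvs hindep hident hpos
    (⟨0, by omega⟩ : Fin d)
  have hd1 : (1 : ℝ) ≤ d := by exact_mod_cast (by omega : 1 ≤ d)
  have hq : 0 ≤ 1 - 1 / (d : ℝ) := by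
    rw [sub_nonneg, div_le_one (by linarith)]
    exact hd1
  refine ⟨ε / 2 / ((3 : ℝ) ^ d) ^ (1 - 1 / (d : ℝ)), by positivity, ?_⟩
  filter_upwards [hae] with ω hω
  obtain ⟨n₁, hn₁⟩ := hω
  -- With `mass ω A ≤ 3 ^ d * #A`, this threshold forces `(d * n₁) ^ 2 < #A`.
  refine ⟨3 ^ d * (d * n₁) ^ 2 + 1, fun A hA h0 hN => ?_⟩
  have hmass := RandomConductance.mass_le ω A
  have hbig : (d * n₁) ^ 2 < A.card := by
    have h1 : ((3 ^ d * (d * n₁) ^ 2 + 1 : ℕ) : ℝ) ≤ ((3 ^ d * A.card : ℕ) : ℝ) :=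
      hN.trans (by exact_mod_cast hmass)
    have h2 : 3 ^ d * (d * n₁) ^ 2 + 1 ≤ 3 ^ d * A.card := by exact_mod_cast h1
    exact lt_of_mul_lt_mul_left (Nat.lt_of_succ_le h2) (Nat.zero_le _)
  refine le_trans ?_
    (RandomConductance.boundaryMass_ge_of_notMem_badEnvs hd hε hn₁ hA h0 hbig)
  calc ε / 2 / ((3 : ℝ) ^ d) ^ (1 - 1 / (d : ℝ)) *
        RandomConductance.mass ω A ^ (1 - 1 / (d : ℝ))
      = ε / 2 * (RandomConductance.mass ω A / 3 ^ d) ^ (1 - 1 / (d : ℝ)) := by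
        rw [Real.div_rpow (RandomConductance.mass_nonneg ω A) (by positivity)]
        ring
    _ ≤ ε / 2 * (A.card : ℝ) ^ (1 - 1 / (d : ℝ)) := by
        have h : RandomConductance.mass ω A / 3 ^ d ≤ A.card := by
          rw [div_le_iff₀ (by positivity), mul_comm]
          exact hmass
        have h0 : 0 ≤ RandomConductance.mass ω A / 3 ^ d :=
          div_nonneg (RandomConductance.mass_nonneg ω A) (by positivity)
        gcongr
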